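/- Let $n\ge 0$ and let $\Gamma$ be a crystallographic group of dimension $n$, that is, a subgroup of the isometry group $E(n)=\mathrm{Isom}(\mathbb R^n)$ of Euclidean space that is discrete and cocompact (the quotient $E(n)/\Gamma$ is compact). Let $\Gamma_{tor}\le\Gamma$ be the subgroup generated by all torsion elements (elements of finite order) of $\Gamma$. Then $\Gamma_{tor}$ is boundedly generated by torsion elements: there is an integer $N$ such that every element of $\Gamma_{tor}$ is a product of at most $N$ torsion elements of $\Gamma$. Consequently the stable torsion length of $\Gamma$ vanishes identically: for every $g\in\Gamma_{tor}$, writing $\mathrm{tl}_\Gamma(g)$ for the least $k$ such that $g$ is a product of $k$ torsion elements of $\Gamma$, the limit $$\mathrm{stl}_\Gamma(g)=\lim_{k\to\infty}\frac{\mathrm{tl}_\Gamma(g^k)}{k}$$ exists and equals $0$. -/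

import Mathlib

open Filter Topology

namespace StableTorsion

section Words

variable {G : Type*} [Group G]

/-- `g` is a product `s₁ ⋯ sₖ` of exactly `k` elements of `S`. -/
def IsProductOf (S : Set G) (k : ℕ) (g : G) : Prop :=
  ∃ l : List G, l.length = k ∧ (∀ s ∈ l, s ∈ S) ∧ l.prod = g

/-- The word length `|g|_S`: the least `k` such that `g` is a product of `k` elements of `S`.
It is meant for symmetric `S` and for `g` in the subgroup generated by `S`
(the set below is then nonempty). -/
noncomputable def wordLength (S : Set G) (g : G) : ℕ :=
  sInf {k : ℕ | IsProductOf S k g}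

/-- The stable word length `‖g‖_S = lim |g ^ k|_S / k`. -/
noncomputable def stableWordLength (S : Set G) (g : G) : ℝ :=
  limUnder atTop (fun k : ℕ => (wordLength S (g ^ k) : ℝ) / (k : ℝ))

/-- The subgroup `H` is boundedly generated by `S`: it is generated by `S`, and there is a uniform
`N` such that each element of `H` is a product of at most `N` elements of `S`. -/
def IsBoundedlyGeneratedBy (H : Subgroup G) (S : Set G) : Prop :=
  Subgroup.closure S = H ∧ ∃ N : ℕ, ∀ g ∈ H, ∃ k ≤ N, IsProductOf S k g

variable (G) in
/-- The set of torsion elements (elements of finite order) of `G`. -/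
def torsionElements : Set G := {g | IsOfFinOrder g}

variable (G) in
/-- The subgroup `G_tor` generated by the torsion elements of `G`. -/
def torsionSubgroup : Subgroup G := Subgroup.closure (torsionElements G)

/-- The torsion length of `g`. -/
noncomputable def tl (g : G) : ℕ := wordLength (torsionElements G) g

/-- The stable torsion length of `g`. -/
noncomputable def stl (g : G) : ℝ := stableWordLength (torsionElements G) g

end Words

/-- The group `E(n)` of isometries of Euclidean space `ℝⁿ`, under composition. -/
abbrev EuclIsom (n : ℕ) : Type := EuclideanSpace ℝ (Fin n) ≃ᵢ EuclideanSpace ℝ (Fin n)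

/-- The usual topology of `E(n)`: pointwise convergence on `ℝⁿ` (for isometries this is the same as
the compact-open topology, and as the Lie group topology of `O(n) ⋉ ℝⁿ`). -/
noncomputable instance instTopologicalSpaceEuclIsom (n : ℕ) : TopologicalSpace (EuclIsom n) :=
  TopologicalSpace.induced
    (fun (γ : EuclIsom n) (x : EuclideanSpace ℝ (Fin n)) => γ x) inferInstance

/-- A crystallographic group of dimension `n`: a subgroup of `E(n)` that is discrete (in the
subspace topology) and cocompact (the coset space is compact in the quotient topology). -/
structure IsCrystallographic {n : ℕ} (Γ : Subgroup (EuclIsom n)) : Prop where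
  discrete : DiscreteTopology Γ
  cocompact : CompactSpace (EuclIsom n ⧸ Γ)

end StableTorsion

/-! By Bieberbach's first theorem the translations in `Γ` form a normal abelian subgroup `A` of
finite index, and `Γ` is finitely generated. The rest is algebra. Write `H` for the torsion
subgroup.

If `t` is torsion and `a ∈ A`, then `⁅t, a⁆ = t * (a * t⁻¹ * a⁻¹)` is a product of two torsion
elements. The map `a ↦ ⁅t, a⁆` is an endomorphism of `A` that depends only on the coset of `t`, so
only finitely many images occur. Their product is a subgroup of bounded torsion length, and it
contains `⁅H, A⁆` (`hasBoundedLength_commutator`).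

It remains to see that `⁅H, A⁆` has finite index in `H`. Modulo `⁅H, A⁆` the group `H` has a centre
of finite index, and the transfer shows that every element of `H` has a positive power in `⁅H, A⁆`
(`exists_pow_mem_commutator`). Since `H ⊓ A` is a finitely generated abelian group, this gives
finite index. Bounded torsion length makes `tl (g ^ k) / k` tend to zero.

Bieberbach's theorem follows from `linearPart_eq_one_of_rotation_le`, a descent in which commutators
produce ever shorter elements. -/

open scoped commutatorElement

namespace StableTorsion

/-! ### Linear parts of isometries and commutator estimates -/

section Rotation

variable {E : Type*} [NormedAddCommGroup E] [InnerProductSpace ℝ E]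

/-- The linear part of an isometry of a Euclidean space. -/
noncomputable def linearPart : (E ≃ᵢ E) →* (E ≃ₗᵢ[ℝ] E) where
  toFun γ := γ.toRealLinearIsometryEquiv
  map_one' := by
    ext x
    exact ((1 : E ≃ᵢ E).toRealLinearIsometryEquiv_apply x).trans (sub_zero x)
  map_mul' α β := by
    ext x
    change (α * β).toRealLinearIsometryEquiv x =
      α.toRealLinearIsometryEquiv (β.toRealLinearIsometryEquiv x)
    rw [β.toRealLinearIsometryEquiv_apply, map_sub]
    simp

theorem apply_eq (γ : E ≃ᵢ E) (x : E) : γ x = linearPart γ x + γ 0 := by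
  simp [linearPart]

theorem apply_sub_apply (γ : E ≃ᵢ E) (x y : E) : γ x - γ y = linearPart γ (x - y) := by
  rw [apply_eq γ x, apply_eq γ y, map_sub]
  abel

/-- The linear part of an isometry, as a continuous linear map. -/
noncomputable def linearMap (γ : E ≃ᵢ E) : E →L[ℝ] E :=
  (linearPart γ).toContinuousLinearEquiv.toContinuousLinearMap

@[simp]
theorem linearMap_apply (γ : E ≃ᵢ E) (x : E) : linearMap γ x = linearPart γ x := rfl

theorem norm_linearMap_le (γ : E ≃ᵢ E) : ‖linearMap γ‖ ≤ 1 :=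
  ContinuousLinearMap.opNorm_le_bound _ zero_le_one fun x => by simp

/-- The distance of the linear part of an isometry from the identity. -/
noncomputable def rotation (γ : E ≃ᵢ E) : ℝ := ‖linearMap γ - 1‖

theorem rotation_nonneg (γ : E ≃ᵢ E) : 0 ≤ rotation γ := norm_nonneg _

theorem rotation_eq_zero {γ : E ≃ᵢ E} : rotation γ = 0 ↔ linearPart γ = 1 := by
  rw [rotation, norm_eq_zero, sub_eq_zero]
  constructor
  · intro h
    ext x
    exact congrArg (fun f : E →L[ℝ] E => f x) h
  · intro h
    ext x
    simp [h]

theorem norm_linearPart_sub_le (γ : E ≃ᵢ E) (x : E) :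
    ‖linearPart γ x - x‖ ≤ rotation γ * ‖x‖ :=
  (linearMap γ - 1).le_opNorm x

theorem rotation_le {γ : E ≃ᵢ E} {c : ℝ} (hc : 0 ≤ c)
    (h : ∀ x, ‖linearPart γ x - x‖ ≤ c * ‖x‖) : rotation γ ≤ c :=
  ContinuousLinearMap.opNorm_le_bound _ hc h

theorem linearPart_inv_apply_apply (γ : E ≃ᵢ E) (x : E) :
    linearPart γ⁻¹ (linearPart γ x) = x := by
  rw [map_inv]
  exact (linearPart γ).symm_apply_apply x

theorem linearPart_apply_inv_apply (γ : E ≃ᵢ E) (x : E) :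
    linearPart γ (linearPart γ⁻¹ x) = x := by
  rw [map_inv]
  exact (linearPart γ).apply_symm_apply x

theorem linearPart_mul_apply (α β : E ≃ᵢ E) (x : E) :
    linearPart (α * β) x = linearPart α (linearPart β x) := by
  rw [map_mul]
  rfl

theorem inv_apply_zero (γ : E ≃ᵢ E) : γ⁻¹ 0 = -linearPart γ⁻¹ (γ 0) := by
  have h := apply_sub_apply γ⁻¹ 0 (γ 0)
  have h' : γ⁻¹ (γ 0) = 0 := γ.symm_apply_apply 0
  rw [h', sub_zero, zero_sub, map_neg] at h
  exact h

theorem mul_apply_zero (α β : E ≃ᵢ E) : (α * β) 0 = linearPart α (β 0) + α 0 :=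
  apply_eq α (β 0)

/-- Quotients of two isometries have linear part close to the identity when their linear parts
are close to each other. -/
theorem rotation_mul_inv_le (α β : E ≃ᵢ E) :
    rotation (α * β⁻¹) ≤ ‖linearMap α - linearMap β‖ := by
  refine rotation_le (norm_nonneg _) fun x => ?_
  have h := (linearMap α - linearMap β).le_opNorm (linearPart β⁻¹ x)
  simpa [linearPart_mul_apply, linearPart_apply_inv_apply] using h

theorem rotation_inv_mul_le (α β : E ≃ᵢ E) :
    rotation (α⁻¹ * β) ≤ ‖linearMap α - linearMap β‖ := by
  refine rotation_le (norm_nonneg _) fun x => ?_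
  have h := (linearMap α - linearMap β).le_opNorm x
  rw [← (linearPart α).norm_map, map_sub, linearPart_mul_apply, linearPart_apply_inv_apply,
    norm_sub_rev]
  simpa using h

theorem norm_inv_mul_apply_zero (α β : E ≃ᵢ E) : ‖(α⁻¹ * β) 0‖ = ‖β 0 - α 0‖ := by
  rw [mul_apply_zero, inv_apply_zero, ← sub_eq_add_neg, ← map_sub, LinearIsometryEquiv.norm_map]

theorem norm_mul_inv_apply_zero_sub_le (α β : E ≃ᵢ E) : ‖(α * β⁻¹) 0 - α 0‖ ≤ ‖β 0‖ := by
  rw [mul_apply_zero, inv_apply_zero, add_sub_cancel_right]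
  simp

/-- For the linear parts, `ABA⁻¹B⁻¹ - 1 = ((A - 1)(B - 1) - (B - 1)(A - 1))A⁻¹B⁻¹`, and `A⁻¹B⁻¹`
preserves norms. -/
theorem rotation_commutator_le (α β : E ≃ᵢ E) :
    rotation ⁅α, β⁆ ≤ 2 * rotation α * rotation β := by
  have hα := rotation_nonneg α
  have hβ := rotation_nonneg β
  refine rotation_le (by positivity) fun x => ?_
  obtain ⟨y, rfl⟩ : ∃ y, x = linearPart β (linearPart α y) :=
    ⟨linearPart α⁻¹ (linearPart β⁻¹ x), by simp only [linearPart_apply_inv_apply]⟩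
  have e : linearPart ⁅α, β⁆ (linearPart β (linearPart α y)) - linearPart β (linearPart α y)
      = (linearPart α (linearPart β y - y) - (linearPart β y - y))
        - (linearPart β (linearPart α y - y) - (linearPart α y - y)) := by
    simp only [commutatorElement_def, linearPart_mul_apply, linearPart_inv_apply_apply, map_sub]
    abel
  rw [e]
  simp only [LinearIsometryEquiv.norm_map]
  have h1 := norm_linearPart_sub_le α (linearPart β y - y)
  have h2 := norm_linearPart_sub_le β (linearPart α y - y)
  have h3 := mul_le_mul_of_nonneg_left (norm_linearPart_sub_le β y) hα
  have h4 := mul_le_mul_of_nonneg_left (norm_linearPart_sub_le α y) hβ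
  refine (norm_sub_le _ _).trans ?_
  linarith

/-- If `β` were a translation by `b`, the commutator would be the translation by `(A - 1)b`. The
right side is the error when `β` only nearly is one. -/
theorem norm_commutator_apply_zero_sub_le (α β : E ≃ᵢ E) :
    ‖⁅α, β⁆ 0 - (linearPart α (β 0) - β 0)‖
      ≤ rotation ⁅α, β⁆ * ‖β 0‖ + rotation β * ‖α 0‖ := by
  have e : ⁅α, β⁆ 0 - (linearPart α (β 0) - β 0)
      = -(linearPart ⁅α, β⁆ (β 0) - β 0)
        - linearPart α (linearPart β (linearPart α⁻¹ (α 0)) - linearPart α⁻¹ (α 0)) := by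
    simp only [commutatorElement_def, linearPart_mul_apply, mul_apply_zero, inv_apply_zero,
      linearPart_apply_inv_apply, map_sub, map_neg]
    abel
  rw [e]
  refine (norm_sub_le _ _).trans (add_le_add ?_ ?_)
  · rw [norm_neg]
    exact norm_linearPart_sub_le _ _
  · rw [LinearIsometryEquiv.norm_map]
    simpa using norm_linearPart_sub_le β (linearPart α⁻¹ (α 0))

/-- `A - 1` is normal for a linear isometry `A`, so `k ↦ ‖(A - 1) ^ k x‖` is log-convex. -/
theorem norm_sq_linearPart_sub_le (α : E ≃ᵢ E) (x : E) :
    ‖linearPart α x - x‖ ^ 2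
      ≤ ‖linearPart α (linearPart α x - x) - (linearPart α x - x)‖ * ‖x‖ := by
  obtain ⟨y, hy⟩ : ∃ y, y = linearPart α x - x := ⟨_, rfl⟩
  rw [← hy]
  have e : inner ℝ y y = inner ℝ x (-(linearPart α⁻¹ (linearPart α y - y))) := by
    have h : inner ℝ (linearPart α x) y = inner ℝ x (linearPart α⁻¹ y) := by
      rw [← (linearPart α).inner_map_map x, linearPart_apply_inv_apply]
    rw [map_sub, linearPart_inv_apply_apply, neg_sub, inner_sub_right, ← h, ← inner_sub_left, ← hy]
  rw [← real_inner_self_eq_norm_sq, e, mul_comm]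
  refine (real_inner_le_norm _ _).trans_eq ?_
  rw [norm_neg, LinearIsometryEquiv.norm_map]

end Rotation

/-! ### Pigeonhole principles in proper spaces -/

theorem finite_of_isBounded_of_separated {α V : Type*} [PseudoMetricSpace V] [ProperSpace V]
    {S : Set α} (f : α → V) (hb : Bornology.IsBounded (f '' S)) {ε : ℝ} (hε : 0 < ε)
    (hs : ∀ x ∈ S, ∀ y ∈ S, dist (f x) (f y) < ε → x = y) : S.Finite := by
  obtain ⟨t, ht, hcov⟩ := Metric.totallyBounded_iff.1 (hb.isCompact_closure.totallyBounded.subset subset_closure) (ε / 2) (half_pos hε)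
  refine (ht.biUnion (t := fun v => {x ∈ S | f x ∈ Metric.ball v (ε / 2)}) fun v _ => ?_).subset
    fun x hx => ?_
  · refine Set.Subsingleton.finite fun x hx y hy => hs x hx.1 y hy.1 ?_
    have h1 := Metric.mem_ball.1 hx.2
    have h2 := Metric.mem_ball.1 hy.2
    linarith [dist_triangle_right (f x) (f y) v]
  · obtain ⟨v, hv, hxv⟩ := Set.mem_iUnion₂.1 (hcov (Set.mem_image_of_mem f hx))
    exact Set.mem_iUnion₂.2 ⟨v, hv, hx, hxv⟩

theorem exists_infinite_dist_lt {V : Type*} [PseudoMetricSpace V] [ProperSpace V] (f : ℕ → V)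
    (hb : Bornology.IsBounded (Set.range f)) {ε : ℝ} (hε : 0 < ε) :
    ∃ J : Set ℕ, J.Infinite ∧ ∀ i ∈ J, ∀ j ∈ J, dist (f i) (f j) < ε := by
  obtain ⟨t, ht, hcov⟩ := Metric.totallyBounded_iff.1 (hb.isCompact_closure.totallyBounded.subset subset_closure) (ε / 2) (half_pos hε)
  by_contra! h
  refine Set.infinite_univ ((ht.biUnion (t := fun v => {i | f i ∈ Metric.ball v (ε / 2)})
    fun v _ => ?_).subset fun i _ => ?_)
  · by_contra hinf
    obtain ⟨i, hi, j, hj, hij⟩ := h _ hinf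
    have h1 := Metric.mem_ball.1 hi
    have h2 := Metric.mem_ball.1 hj
    linarith [dist_triangle_right (f i) (f j) v]
  · obtain ⟨v, hv, hxv⟩ := Set.mem_iUnion₂.1 (hcov (Set.mem_range_self i))
    exact Set.mem_iUnion₂.2 ⟨v, hv, hxv⟩

/-! ### Finite generation and Bieberbach's first theorem -/

section Bieberbach

variable {E : Type*} [NormedAddCommGroup E] [InnerProductSpace ℝ E]

/-- Every point is within distance `d` of the orbit of the origin, for some `d`. -/
def HasCoboundedOrbit (Γ : Subgroup (E ≃ᵢ E)) : Prop :=
  ∃ d : ℝ, ∀ x : E, ∃ γ ∈ Γ, ‖γ 0 - x‖ ≤ d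

/-- The identity is the only element with small linear and translation parts. -/
def IsUniformlyDiscrete (Γ : Subgroup (E ≃ᵢ E)) : Prop :=
  ∃ ε > 0, ∀ γ ∈ Γ, rotation γ < ε → ‖γ 0‖ < ε → γ = 1

variable {Γ : Subgroup (E ≃ᵢ E)}

theorem HasCoboundedOrbit.fg (hc : HasCoboundedOrbit Γ)
    (hfin : ∀ R : ℝ, {γ | γ ∈ Γ ∧ ‖γ 0‖ ≤ R}.Finite) : Γ.FG := by
  obtain ⟨d, hd⟩ := hc
  obtain ⟨γ₀, -, h₀⟩ := hd 0
  have hd0 : 0 ≤ d := (norm_nonneg _).trans h₀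
  rw [Subgroup.fg_iff]
  refine ⟨_, ?_, hfin (2 * d + 1)⟩
  set S := {γ | γ ∈ Γ ∧ ‖γ 0‖ ≤ 2 * d + 1} with hS
  refine le_antisymm ((Subgroup.closure_le _).2 fun γ hγ => hγ.1) ?_
  have key : ∀ k : ℕ, ∀ γ ∈ Γ, ‖γ 0‖ ≤ 2 * d + 1 + k → γ ∈ Subgroup.closure S := by
    intro k
    induction k with
    | zero => exact fun γ hγ h => Subgroup.subset_closure ⟨hγ, by simpa using h⟩
    | succ k ih =>
      intro γ hγ h
      by_cases hle : ‖γ 0‖ ≤ 2 * d + 1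
      · exact Subgroup.subset_closure ⟨hγ, hle⟩
      push Not at hle
      have hpos : 0 < ‖γ 0‖ := by linarith
      -- Move from `γ 0` towards the origin by `d + 1`. An orbit point within `d` of the place
      -- reached is at least 1 closer to the origin, and at most `2 * d + 1` from `γ 0`.
      obtain ⟨s, hs⟩ : ∃ s, s = (d + 1) / ‖γ 0‖ := ⟨_, rfl⟩
      have hsx : s * ‖γ 0‖ = d + 1 := by rw [hs]; field_simp
      have hs0 : 0 ≤ s := by rw [hs]; positivity
      have hs1 : s ≤ 1 := by
        rw [hs, div_le_one hpos]
        linarith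
      obtain ⟨δ, hδ, hδd⟩ := hd ((1 - s) • γ 0)
      have h1 : ‖(1 - s) • γ 0‖ = ‖γ 0‖ - (d + 1) := by
        rw [norm_smul, Real.norm_of_nonneg (by linarith), sub_mul, hsx, one_mul]
      have h2 : ‖γ 0 - (1 - s) • γ 0‖ = d + 1 := by
        rw [sub_smul, one_smul, sub_sub_cancel, norm_smul, Real.norm_of_nonneg hs0, hsx]
      have h3 : δ ∈ Subgroup.closure S := by
        refine ih δ hδ ?_
        have := norm_le_norm_add_norm_sub' (δ 0) ((1 - s) • γ 0)
        push_cast at h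
        linarith
      have h4 : δ⁻¹ * γ ∈ Subgroup.closure S := by
        refine Subgroup.subset_closure ⟨Γ.mul_mem (Γ.inv_mem hδ) hγ, ?_⟩
        rw [norm_inv_mul_apply_zero]
        have := norm_sub_le_norm_sub_add_norm_sub (γ 0) ((1 - s) • γ 0) (δ 0)
        linarith [norm_sub_rev ((1 - s) • γ 0) (δ 0)]
      simpa using Subgroup.mul_mem _ h3 h4
  intro γ hγ
  obtain ⟨k, hk⟩ := exists_nat_ge ‖γ 0‖
  exact key k γ hγ (by linarith)

/-- The translations in `Γ`. -/
noncomputable def translations (Γ : Subgroup (E ≃ᵢ E)) : Subgroup Γ :=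
  (linearPart.comp Γ.subtype).ker

theorem mul_comm_of_mem_translations {α β : Γ} (hα : α ∈ translations Γ)
    (hβ : β ∈ translations Γ) : α * β = β * α := by
  have h1 : linearPart (α : E ≃ᵢ E) = 1 := hα
  have h2 : linearPart (β : E ≃ᵢ E) = 1 := hβ
  refine Subtype.ext (IsometryEquiv.ext fun x => ?_)
  change (α : E ≃ᵢ E) ((β : E ≃ᵢ E) x) = (β : E ≃ᵢ E) ((α : E ≃ᵢ E) x)
  rw [apply_eq (α : E ≃ᵢ E) ((β : E ≃ᵢ E) x), apply_eq (β : E ≃ᵢ E) ((α : E ≃ᵢ E) x),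
    apply_eq (α : E ≃ᵢ E) x, apply_eq (β : E ≃ᵢ E) x, h1, h2]
  simp only [LinearIsometryEquiv.coe_one, id]
  abel

theorem isBounded_image_linearMap (S : Set (E ≃ᵢ E)) :
    Bornology.IsBounded (linearMap '' S) := by
  refine isBounded_iff_forall_norm_le.2 ⟨1, ?_⟩
  rintro _ ⟨γ, -, rfl⟩
  exact norm_linearMap_le γ

variable [FiniteDimensional ℝ E]

instance : ProperSpace (E →L[ℝ] E) := FiniteDimensional.proper ℝ _

theorem IsUniformlyDiscrete.finite_setOf_norm_le (hΓ : IsUniformlyDiscrete Γ) (R : ℝ) :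
    {γ | γ ∈ Γ ∧ ‖γ 0‖ ≤ R}.Finite := by
  obtain ⟨ε, hε, h⟩ := hΓ
  have : ProperSpace E := FiniteDimensional.proper ℝ _
  refine finite_of_isBounded_of_separated (fun γ : E ≃ᵢ E => (linearMap γ, γ 0)) ?_ hε ?_
  · refine isBounded_iff_forall_norm_le.2 ⟨max 1 R, ?_⟩
    rintro _ ⟨γ, ⟨-, hγ⟩, rfl⟩
    exact max_le_max (norm_linearMap_le γ) hγ
  · rintro α ⟨hα, -⟩ β ⟨hβ, -⟩ hαβ
    obtain ⟨h1, h2⟩ := max_lt_iff.1 hαβ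
    rw [dist_eq_norm] at h1 h2
    rw [← inv_mul_eq_one]
    refine h _ (Γ.mul_mem (Γ.inv_mem hα) hβ) ((rotation_inv_mul_le α β).trans_lt h1) ?_
    rwa [norm_inv_mul_apply_zero, norm_sub_rev]

theorem IsUniformlyDiscrete.exists_norm_minimal (hΓ : IsUniformlyDiscrete Γ)
    (p : (E ≃ᵢ E) → Prop) (hp : ∃ γ ∈ Γ, p γ) :
    ∃ γ ∈ Γ, p γ ∧ ∀ δ ∈ Γ, p δ → ‖γ 0‖ ≤ ‖δ 0‖ := by
  obtain ⟨γ₀, h₀, hp₀⟩ := hp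
  obtain ⟨γ, ⟨⟨hγ, hle⟩, hpγ⟩, hmin⟩ :=
    ((hΓ.finite_setOf_norm_le ‖γ₀ 0‖).inter_of_left {γ | p γ}).exists_minimalFor
      (fun γ => ‖γ 0‖) _ ⟨γ₀, ⟨h₀, le_rfl⟩, hp₀⟩
  refine ⟨γ, hγ, hpγ, fun δ hδ hpδ => ?_⟩
  rcases le_total ‖δ 0‖ ‖γ₀ 0‖ with h | h
  · rcases le_total ‖γ 0‖ ‖δ 0‖ with h' | h'
    · exact h'
    · exact hmin ⟨⟨hδ, h⟩, hpδ⟩ h'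
  · exact hle.trans h

/-- In each direction `u` there is an element of `Γ` translating nearly along `u` and with small
linear part. -/
theorem HasCoboundedOrbit.exists_rotation_le (hc : HasCoboundedOrbit Γ) (u : E) {ε : ℝ}
    (hε : 0 < ε) : ∃ β ∈ Γ, rotation β ≤ ε ∧ ∃ s > 0, ‖β 0 - s • u‖ ≤ s * ε := by
  obtain ⟨d, hd⟩ := hc
  choose γ hγ hγd using fun k : ℕ => hd ((k : ℝ) • u)
  obtain ⟨J, hJ, hJε⟩ := exists_infinite_dist_lt (fun k => linearMap (γ k))
    ((isBounded_image_linearMap Set.univ).subset (by rintro _ ⟨k, rfl⟩; exact ⟨_, trivial, rfl⟩)) hε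
  obtain ⟨i, hi⟩ := hJ.nonempty
  -- With `i` fixed, dividing by `γ i` shifts the translation part by at most `‖γ i 0‖`, which is
  -- negligible relative to `j` once `j` is large.
  obtain ⟨k, hk⟩ := exists_nat_ge ((‖γ i 0‖ + d) / ε)
  obtain ⟨j, hj, hkj⟩ := hJ.exists_gt k
  have hkj' : (k : ℝ) < j := by exact_mod_cast hkj
  refine ⟨γ j * (γ i)⁻¹, Γ.mul_mem (hγ j) (Γ.inv_mem (hγ i)), ?_, j, ?_, ?_⟩
  · refine (rotation_mul_inv_le _ _).trans ?_
    rw [← dist_eq_norm]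
    exact (hJε j hj i hi).le
  · exact (Nat.cast_nonneg k).trans_lt hkj'
  · have h1 := norm_sub_le_norm_sub_add_norm_sub ((γ j * (γ i)⁻¹) 0) (γ j 0) ((j : ℝ) • u)
    have h2 := norm_mul_inv_apply_zero_sub_le (γ j) (γ i)
    have h3 := (div_le_iff₀ hε).1 (hk.trans hkj'.le)
    linarith [hγd j]

/-- Arithmetic of the descent below. Put `N = A - 1`. Then `b, X, Y` are the norms of `β 0` and its
images under `N` and `N ^ 2`; `m, B, R` are the rotations of `α`, `β`, `⁅α, β⁆`; `n, Z` are the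
norms of `⁅α, β⁆ 0` and its image under `N`; and `r` is the error in `⁅α, β⁆ 0 ≈ N (β 0)`. The
invariant says `X / b ≥ c + B / c`. By log-convexity `Y / X ≥ X / b`, while the rotation shrinks by
the factor `2 * m ≤ 1 / 4`. The slack so gained absorbs the errors, which are proportional to `B`.
-/
theorem commutator_ratio_bound {b X Y B r m c n Z R : ℝ} (hb : 0 < b) (hB : 0 ≤ B) (hc : 0 < c)
    (hc' : c ≤ 1 / 16) (hm : 0 ≤ m) (hm' : m ≤ 1 / 8) (hr0 : 0 ≤ r) (hX : B * b ≤ c * (X - c * b))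
    (hY : X ^ 2 ≤ Y * b) (hr : r ≤ 5 / 4 * (B * b)) (hn : n ≤ X + r) (hn0 : 0 ≤ n)
    (hZ : Y - m * r ≤ Z) (hR : R ≤ 2 * m * B) : R * n ≤ c * (Z - c * n) := by
  have hBb : 0 ≤ B * b := by positivity
  have hXb : c * b ≤ X := by
    by_contra! h
    nlinarith
  have hX0 : 0 ≤ X := le_trans (by positivity) hXb
  have hP : 0 ≤ X * (B * b) := by positivity
  have e1 : X * (B * b) ≤ c * X ^ 2 - c ^ 2 * X * b := by nlinarith
  have e2 : m * (X * (B * b)) ≤ 1 / 8 * (X * (B * b)) := by gcongr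
  have hXr : X * r ≤ 5 / 4 * (X * (B * b)) := by nlinarith
  have hXr0 : 0 ≤ X * r := by positivity
  have e3 : c * (c * b) * r ≤ 1 / 16 * (X * r) := by
    calc c * (c * b) * r ≤ 1 / 16 * X * r := by gcongr
      _ = _ := by ring
  have e4 : m * (c * b) * r ≤ 1 / 8 * (X * r) := by
    calc m * (c * b) * r ≤ 1 / 8 * X * r := by gcongr
      _ = _ := by ring
  have hBX : B * b ≤ X / 16 := by nlinarith
  have e5 : m * (B * b) * r ≤ 1 / 8 * (X / 16) * r := by gcongr
  have e6 : R * n ≤ 2 * m * B * (X + r) := by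
    calc R * n ≤ 2 * m * B * n := by gcongr
      _ ≤ _ := by gcongr
  have e7 : c ^ 2 * n ≤ c ^ 2 * (X + r) := by gcongr
  have e8 : c * (Y - m * r) ≤ c * Z := by gcongr
  have e9 : c * X ^ 2 ≤ c * (Y * b) := by gcongr
  refine le_of_mul_le_mul_right ?_ hb
  have f6 := mul_le_mul_of_nonneg_right e6 hb.le
  have f7 := mul_le_mul_of_nonneg_right e7 hb.le
  have f8 := mul_le_mul_of_nonneg_right e8 hb.le
  linarith

/-- An element of a crystallographic group whose linear part is close to the identity is a
translation. -/
theorem linearPart_eq_one_of_rotation_le (hc : HasCoboundedOrbit Γ) (hd : IsUniformlyDiscrete Γ)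
    {γ : E ≃ᵢ E} (hγ : γ ∈ Γ) (h : rotation γ ≤ 1 / 8) : linearPart γ = 1 := by
  by_contra hne
  -- Take a counterexample `α` with shortest translation part. Its minimality is used to bound `‖α
  -- 0‖` by `‖β 0‖` for the elements `β` constructed next.
  obtain ⟨α, hα, ⟨hαr, hα1⟩, hαmin⟩ := hd.exists_norm_minimal
    (fun γ => rotation γ ≤ 1 / 8 ∧ linearPart γ ≠ 1) ⟨γ, hγ, h, hne⟩
  have hm := rotation_nonneg α
  have hN := norm_linearPart_sub_le α
  obtain ⟨u, hu, hNu⟩ : ∃ u : E, ‖u‖ = 1 ∧ linearPart α u - u ≠ 0 := by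
    obtain ⟨v, hv⟩ : ∃ v : E, linearPart α v - v ≠ 0 := by
      by_contra! h0
      exact hα1 (LinearIsometryEquiv.ext fun x => sub_eq_zero.1 (h0 x))
    have hv0 : v ≠ 0 := by
      rintro rfl
      simp at hv
    refine ⟨‖v‖⁻¹ • v, norm_smul_inv_norm hv0, ?_⟩
    rw [map_smul, ← smul_sub]
    exact smul_ne_zero (by simpa using hv0) hv
  -- The factor 2 leaves room: `u` is moved by `2 * c`, while the invariant below asks for little
  -- more than `c` when `β` has small rotation.
  obtain ⟨c, hcu⟩ : ∃ c, ‖linearPart α u - u‖ = 2 * c := ⟨_, (mul_div_cancel₀ _ two_ne_zero).symm⟩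
  have hc0 : 0 < c := by
    have := norm_pos_iff.2 hNu
    linarith
  have hc16 : c ≤ 1 / 16 := by
    have := hN u
    rw [hu, hcu] at this
    linarith
  -- Among the elements whose translation part is moved substantially by `α`, relative to their own
  -- rotation, take a shortest one. Elements translating nearly along `u` with small rotation show
  -- that there are some.
  obtain ⟨β, hβ, ⟨hβ0, hβr⟩, hβmin⟩ := hd.exists_norm_minimal
    (fun β => 0 < ‖β 0‖ ∧
      rotation β * ‖β 0‖ ≤ c * (‖linearPart α (β 0) - β 0‖ - c * ‖β 0‖)) <| by
    obtain ⟨β, hβ, hβr, s, hs, hβs⟩ := hc.exists_rotation_le u (ε := c ^ 2 / 4) (by positivity)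
    have h1 : ‖s • u‖ = s := by rw [norm_smul, hu, Real.norm_of_nonneg hs.le, mul_one]
    have h2 : ‖linearPart α (s • u) - s • u‖ = s * (2 * c) := by
      rw [map_smul, ← smul_sub, norm_smul, Real.norm_of_nonneg hs.le, hcu]
    have h3 := abs_le.1 (abs_norm_sub_norm_le (β 0) (s • u))
    have h4 := hN (β 0 - s • u)
    have h5 : ‖linearPart α (s • u) - s • u‖ - ‖linearPart α (β 0) - β 0‖
        ≤ ‖linearPart α (β 0 - s • u) - (β 0 - s • u)‖ := by
      refine (norm_sub_norm_le _ _).trans_eq ?_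
      rw [norm_sub_rev, map_sub]
      congr 1
      abel
    rw [h1] at h3
    rw [h2] at h5
    have hc2 : c ^ 2 ≤ 1 / 16 * c := by nlinarith
    have hsc : s * c ^ 2 ≤ 1 / 256 * s := by nlinarith
    have h6 : rotation α * ‖β 0 - s • u‖ ≤ 1 / 8 * (s * (c ^ 2 / 4)) := by gcongr
    have h7 : ‖β 0‖ ≤ 2 * s := by linarith
    refine ⟨β, hβ, by linarith, ?_⟩
    have h8 : rotation β * ‖β 0‖ ≤ c ^ 2 / 4 * (s * (1 + c ^ 2 / 4)) := by
      gcongr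
      linarith
    have h9 : s * (2 * c) - 1 / 8 * (s * (c ^ 2 / 4)) - c * (s * (1 + c ^ 2 / 4))
        ≤ ‖linearPart α (β 0) - β 0‖ - c * ‖β 0‖ := by
      have : c * ‖β 0‖ ≤ c * (s * (1 + c ^ 2 / 4)) := by
        gcongr
        linarith
      linarith
    refine h8.trans (le_trans ?_ (mul_le_mul_of_nonneg_left h9 hc0.le))
    have h10 : 0 ≤ s * c ^ 2 := by positivity
    have h11 : (1 + c ^ 2 / 4) / 4 ≤ 1 - c / 32 - c ^ 2 / 4 := by linarith
    have := mul_le_mul_of_nonneg_left h11 h10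
    linarith
  have hB := rotation_nonneg β
  obtain ⟨b, hb⟩ : ∃ b, b = β 0 := ⟨_, rfl⟩
  rw [← hb] at hβ0 hβr hβmin
  have hX := hN b
  have hX0 : c * ‖b‖ ≤ ‖linearPart α b - b‖ := by
    by_contra! h0
    have : 0 ≤ rotation β * ‖b‖ := by positivity
    nlinarith
  have hB8 : rotation β ≤ 1 / 8 := by
    refine le_of_mul_le_mul_right ?_ hβ0
    have h1 : rotation α * ‖b‖ ≤ 1 / 8 * ‖b‖ := by gcongr
    have h2 : c * (‖linearPart α b - b‖ - c * ‖b‖) ≤ 1 * (‖linearPart α b - b‖ - c * ‖b‖) := by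
      gcongr
      linarith
    have h3 : 0 ≤ c * ‖b‖ := by positivity
    linarith
  -- Either `β` is a translation and both sides vanish, or `β` competes with `α` for minimality.
  have hBa : rotation β * ‖α 0‖ ≤ rotation β * ‖b‖ := by
    by_cases h1 : linearPart β = 1
    · rw [rotation_eq_zero.2 h1, zero_mul, zero_mul]
    · rw [hb]
      exact mul_le_mul_of_nonneg_left (hαmin β hβ ⟨hB8, h1⟩) hB
  obtain ⟨r, hr⟩ : ∃ r, r = ⁅α, β⁆ 0 - (linearPart α b - b) := ⟨_, rfl⟩
  have hr' : ⁅α, β⁆ 0 = (linearPart α b - b) + r := by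
    rw [hr]
    abel
  have hcomm := rotation_commutator_le α β
  have hrle : ‖r‖ ≤ 5 / 4 * (rotation β * ‖b‖) := by
    have h1 := norm_commutator_apply_zero_sub_le α β
    rw [← hb, ← hr] at h1
    have h2 : rotation ⁅α, β⁆ * ‖b‖ ≤ 2 * (1 / 8) * rotation β * ‖b‖ := by
      refine mul_le_mul_of_nonneg_right (hcomm.trans ?_) hβ0.le
      gcongr
    linarith
  have hn : ‖⁅α, β⁆ 0‖ ≤ ‖linearPart α b - b‖ + ‖r‖ := hr' ▸ norm_add_le _ _
  have hn' : ‖linearPart α b - b‖ - ‖r‖ ≤ ‖⁅α, β⁆ 0‖ := by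
    rw [hr', sub_le_iff_le_add]
    exact norm_le_add_norm_add _ _
  have hZ : ‖linearPart α (linearPart α b - b) - (linearPart α b - b)‖ - rotation α * ‖r‖
      ≤ ‖linearPart α (⁅α, β⁆ 0) - ⁅α, β⁆ 0‖ := by
    have e : linearPart α (⁅α, β⁆ 0) - ⁅α, β⁆ 0
        = (linearPart α (linearPart α b - b) - (linearPart α b - b)) + (linearPart α r - r) := by
      rw [hr', map_add]
      abel
    rw [e]
    have h1 := norm_le_add_norm_add (linearPart α (linearPart α b - b) - (linearPart α b - b))
      (linearPart α r - r)
    linarith [hN r]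
  have hmem : ⁅α, β⁆ ∈ Γ :=
    Γ.mul_mem (Γ.mul_mem (Γ.mul_mem hα hβ) (Γ.inv_mem hα)) (Γ.inv_mem hβ)
  have hBX : rotation β * ‖b‖ ≤ 1 / 16 * ‖linearPart α b - b‖ := by
    refine hβr.trans ?_
    have h1 : c * ‖linearPart α b - b‖ ≤ 1 / 16 * ‖linearPart α b - b‖ := by gcongr
    have h2 : 0 ≤ c * (c * ‖b‖) := by positivity
    linarith
  have hXpos : 0 < ‖linearPart α b - b‖ := lt_of_lt_of_le (by positivity) hX0
  -- The commutator satisfies the invariant again, yet its translation part is shorter than `b`,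
  -- since `X ≤ ‖b‖ / 8` and the error is at most `5 / 64 * X`.
  have hfinal := hβmin _ hmem ⟨by linarith, commutator_ratio_bound hβ0 hB hc0 hc16 hm hαr
    (norm_nonneg r) hβr (norm_sq_linearPart_sub_le α b) hrle hn (norm_nonneg _) hZ hcomm⟩
  have h1 : rotation α * ‖b‖ ≤ 1 / 8 * ‖b‖ := by gcongr
  linarith

/-- **Bieberbach's first theorem**: translations have finite index in a crystallographic group. -/
theorem finiteIndex_translations (hc : HasCoboundedOrbit Γ) (hd : IsUniformlyDiscrete Γ) :
    (translations Γ).FiniteIndex := by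
  have hfin : (Set.range (linearPart.comp Γ.subtype)).Finite := by
    refine finite_of_isBounded_of_separated
      (fun A : E ≃ₗᵢ[ℝ] E => (A.toContinuousLinearEquiv.toContinuousLinearMap : E →L[ℝ] E))
      ((isBounded_image_linearMap Set.univ).subset ?_) (ε := 1 / 8) (by norm_num) ?_
    · rintro _ ⟨_, ⟨γ, rfl⟩, rfl⟩
      exact ⟨γ, trivial, rfl⟩
    · rintro _ ⟨α, rfl⟩ _ ⟨β, rfl⟩ hαβ
      rw [dist_eq_norm] at hαβ
      have h := linearPart_eq_one_of_rotation_le hc hd (Γ.mul_mem (Γ.inv_mem α.2) β.2)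
        ((rotation_inv_mul_le (α : E ≃ᵢ E) β).trans hαβ.le)
      rw [map_mul, map_inv, inv_mul_eq_one] at h
      exact h
  have : Finite (linearPart.comp Γ.subtype).range := hfin
  exact Subgroup.finiteIndex_ker _

end Bieberbach

/-! ### From the topological hypotheses to metric ones -/

/-- Translation by a vector, as an isometry of `ℝⁿ`. -/
noncomputable def translation {n : ℕ} (v : EuclideanSpace ℝ (Fin n)) : EuclIsom n :=
  IsometryEquiv.addRight v

theorem continuous_apply_euclIsom {n : ℕ} (x : EuclideanSpace ℝ (Fin n)) :
    Continuous fun g : EuclIsom n => g x :=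
  (continuous_apply x).comp continuous_induced_dom

theorem IsCrystallographic.hasCoboundedOrbit {n : ℕ} {Γ : Subgroup (EuclIsom n)}
    (hΓ : IsCrystallographic Γ) : HasCoboundedOrbit Γ := by
  have := hΓ.cocompact
  -- `U k` consists of the cosets with a representative moving the origin by less than `k`. These
  -- sets form an increasing open cover, so a single one is everything; the coset of the translation
  -- by `-x` then yields an orbit point near `x`.
  obtain ⟨U, hU⟩ : ∃ U : ℕ → Set (EuclIsom n ⧸ Γ),
      ∀ k (g : EuclIsom n), (g : EuclIsom n ⧸ Γ) ∈ U k ↔ ∃ γ ∈ Γ, ‖g (γ 0)‖ < k := by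
    refine ⟨fun k => {q | ∃ g : EuclIsom n, (g : EuclIsom n ⧸ Γ) = q ∧ ‖g 0‖ < k},
      fun k g => ⟨?_, ?_⟩⟩
    · rintro ⟨h, hq, hk⟩
      refine ⟨g⁻¹ * h, QuotientGroup.eq.1 hq.symm, ?_⟩
      rwa [← IsometryEquiv.mul_apply, mul_inv_cancel_left]
    · rintro ⟨γ, hγ, hk⟩
      exact ⟨g * γ, QuotientGroup.eq.2 (by simpa using hγ), hk⟩
  have hopen : ∀ k, IsOpen (U k) := by
    intro k
    rw [← (QuotientGroup.isQuotientMap_mk (N := Γ)).isOpen_preimage]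
    have e : (QuotientGroup.mk : EuclIsom n → EuclIsom n ⧸ Γ) ⁻¹' U k
        = ⋃ γ ∈ Γ, {g | ‖g (γ 0)‖ < k} := by
      ext g
      simpa using hU k g
    rw [e]
    exact isOpen_biUnion fun γ _ => isOpen_lt (continuous_apply_euclIsom _).norm continuous_const
  have hcov : Set.univ ⊆ ⋃ k, U k := by
    intro q _
    obtain ⟨g, rfl⟩ := QuotientGroup.mk_surjective q
    obtain ⟨k, hk⟩ := exists_nat_gt ‖g 0‖
    exact Set.mem_iUnion.2 ⟨k, (hU k g).2 ⟨1, Γ.one_mem, hk⟩⟩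
  have hmono : Monotone U := by
    intro j k hjk q hq
    obtain ⟨g, rfl⟩ := QuotientGroup.mk_surjective q
    obtain ⟨γ, hγ, h⟩ := (hU j g).1 hq
    exact (hU k g).2 ⟨γ, hγ, h.trans_le (by exact_mod_cast hjk)⟩
  obtain ⟨k, hk⟩ := isCompact_univ.elim_directed_cover U hopen hcov hmono.directed_le
  refine ⟨k, fun x => ?_⟩
  obtain ⟨γ, hγ, h⟩ := (hU k (translation (-x))).1 (hk trivial)
  exact ⟨γ, hγ, by simpa [translation, sub_eq_add_neg] using h.le⟩

theorem IsCrystallographic.isUniformlyDiscrete {n : ℕ} {Γ : Subgroup (EuclIsom n)}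
    (hΓ : IsCrystallographic Γ) : IsUniformlyDiscrete Γ := by
  have := hΓ.discrete
  let ev : Γ → EuclideanSpace ℝ (Fin n) → EuclideanSpace ℝ (Fin n) := fun γ x => (γ : EuclIsom n) x
  have hev : IsInducing ev :=
    (IsInducing.induced (fun (γ : EuclIsom n) (x : EuclideanSpace ℝ (Fin n)) => γ x)).comp
      IsInducing.subtypeVal
  have h1 : ({1} : Set Γ) ∈ 𝓝 (1 : Γ) := by simp
  rw [hev.nhds_eq_comap, Filter.mem_comap] at h1
  obtain ⟨V, hV, hV1⟩ := h1
  rw [nhds_pi, Filter.mem_pi'] at hV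
  obtain ⟨I, t, ht, htV⟩ := hV
  choose ε hε hεt using fun x => Metric.mem_nhds_iff.1 (ht x)
  -- A basic neighbourhood of the identity constrains only finitely many points `x`, and `‖γ x - x‖
  -- ≤ rotation γ * ‖x‖ + ‖γ 0‖`, so one `δ` serves them all.
  have key : ∃ δ > 0, ∀ x ∈ I, δ * (‖x‖ + 1) ≤ ε x := by
    classical
    clear htV
    induction I using Finset.induction_on with
    | empty => exact ⟨1, one_pos, by simp⟩
    | insert x I _ ih =>
      obtain ⟨δ, hδ, h⟩ := ih
      have hx : 0 < ‖x‖ + 1 := by positivity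
      refine ⟨min δ (ε x / (‖x‖ + 1)), lt_min hδ (div_pos (hε x) hx), ?_⟩
      intro y hy
      rcases Finset.mem_insert.1 hy with rfl | hy
      · exact (le_div_iff₀ hx).1 (min_le_right _ _)
      · exact le_trans (by gcongr; exact min_le_left _ _) (h y hy)
  obtain ⟨δ, hδ, h⟩ := key
  refine ⟨δ, hδ, fun γ hγ hr h0 => ?_⟩
  have hmem : (⟨γ, hγ⟩ : Γ) ∈ ev ⁻¹' V := by
    refine htV fun x hx => hεt x ?_
    rw [Metric.mem_ball, dist_eq_norm]
    change ‖γ x - x‖ < ε x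
    refine lt_of_lt_of_le ?_ (h x hx)
    have e : γ x - x = (linearPart γ x - x) + γ 0 := by
      rw [apply_eq]
      abel
    have h2 : rotation γ * ‖x‖ ≤ δ * ‖x‖ := by gcongr
    rw [e]
    linarith [norm_add_le (linearPart γ x - x) (γ 0), norm_linearPart_sub_le γ x]
  exact congrArg Subtype.val (hV1 hmem)

/-! ### Finitely generated abelian groups -/

section CommGroup

variable {C : Type*} [CommGroup C]

theorem group_fg_subgroup_of_commGroup [Group.FG C] (K : Subgroup C) : Group.FG K := by
  have hC : Module.Finite ℤ (Additive C) := Module.Finite.iff_addGroup_fg.2 inferInstance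
  have hK := IsNoetherian.noetherian (R := ℤ) (AddSubgroup.toIntSubmodule K.toAddSubgroup)
  rw [Submodule.fg_iff_addSubgroup_fg, AddSubgroup.toIntSubmodule_toAddSubgroup] at hK
  exact (Group.fg_iff_subgroup_fg K).2 ((Subgroup.fg_iff_add_fg K).2 hK)

/-- The quotient of `K` by its intersection with `M` is finitely generated, abelian and torsion,
hence finite. -/
theorem relIndex_ne_zero_of_forall_exists_pow_mem [Group.FG C] {M K : Subgroup C}
    (h : ∀ x ∈ K, ∃ n > 0, x ^ n ∈ M) : M.relIndex K ≠ 0 := by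
  have := group_fg_subgroup_of_commGroup K
  have : Finite (K ⧸ M.subgroupOf K) := by
    refine CommGroup.finite_of_fg_isMulTorsion _ fun q => ?_
    obtain ⟨x, rfl⟩ := QuotientGroup.mk_surjective q
    obtain ⟨n, hn, hx⟩ := h x x.2
    refine isOfFinOrder_iff_pow_eq_one.2 ⟨n, hn, ?_⟩
    rw [← QuotientGroup.mk_pow, QuotientGroup.eq_one_iff]
    exact hx
  exact Subgroup.index_ne_zero_of_finite

end CommGroup

/-! ### Calculus of bounded word length -/

section Words

variable {G : Type*} [Group G] {S : Set G}

theorem IsProductOf.mul {j k : ℕ} {g h : G} (hg : IsProductOf S j g) (hh : IsProductOf S k h) :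
    IsProductOf S (j + k) (g * h) := by
  obtain ⟨l, rfl, hl, rfl⟩ := hg
  obtain ⟨l', rfl, hl', rfl⟩ := hh
  refine ⟨l ++ l', List.length_append, fun s hs => ?_, List.prod_append⟩
  exact (List.mem_append.1 hs).elim (hl s) (hl' s)

theorem isProductOf_zero : IsProductOf S 0 (1 : G) :=
  ⟨[], rfl, by simp, rfl⟩

theorem isProductOf_one {s : G} (hs : s ∈ S) : IsProductOf S 1 s :=
  ⟨[s], rfl, by simpa using hs, by simp⟩

theorem exists_isProductOf_of_mem_closure (hS : ∀ s ∈ S, s⁻¹ ∈ S) {g : G}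
    (hg : g ∈ Subgroup.closure S) : ∃ k, IsProductOf S k g := by
  induction hg using Subgroup.closure_induction'' with
  | mem x hx => exact ⟨1, isProductOf_one hx⟩
  | inv_mem x hx => exact ⟨1, isProductOf_one (hS x hx)⟩
  | one => exact ⟨0, isProductOf_zero⟩
  | mul x y _ _ hx hy =>
    obtain ⟨j, hj⟩ := hx
    obtain ⟨k, hk⟩ := hy
    exact ⟨j + k, hj.mul hk⟩

/-- The elements of `X` are products of boundedly many elements of `S`. -/
def HasBoundedLength (S X : Set G) : Prop :=
  ∃ N : ℕ, ∀ g ∈ X, ∃ k ≤ N, IsProductOf S k g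

theorem HasBoundedLength.mono {X Y : Set G} (h : HasBoundedLength S Y) (hXY : X ⊆ Y) :
    HasBoundedLength S X :=
  h.imp fun _ hN g hg => hN g (hXY hg)

theorem HasBoundedLength.mul {X Y : Set G} (hX : HasBoundedLength S X)
    (hY : HasBoundedLength S Y) : HasBoundedLength S {g | ∃ x ∈ X, ∃ y ∈ Y, x * y = g} := by
  obtain ⟨N, hN⟩ := hX
  obtain ⟨N', hN'⟩ := hY
  refine ⟨N + N', ?_⟩
  rintro _ ⟨x, hx, y, hy, rfl⟩
  obtain ⟨j, hj, hj'⟩ := hN x hx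
  obtain ⟨k, hk, hk'⟩ := hN' y hy
  exact ⟨j + k, add_le_add hj hk, hj'.mul hk'⟩

/-- Each element is one of finitely many coset representatives times an element of `M`. The
representatives have bounded length merely because they are finite in number. -/
theorem HasBoundedLength.closure_of_relIndex_ne_zero (hS : ∀ s ∈ S, s⁻¹ ∈ S) {M : Subgroup G}
    (hM : HasBoundedLength S (M : Set G)) (hi : M.relIndex (Subgroup.closure S) ≠ 0) :
    HasBoundedLength S (Subgroup.closure S : Set G) := by
  have : (M.subgroupOf (Subgroup.closure S)).FiniteIndex := ⟨hi⟩
  have hR : HasBoundedLength S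
      (Set.range fun q : Subgroup.closure S ⧸ M.subgroupOf (Subgroup.closure S) =>
        (q.out : G)) := by
    choose ℓ hℓ using fun q : Subgroup.closure S ⧸ M.subgroupOf (Subgroup.closure S) =>
      exists_isProductOf_of_mem_closure hS q.out.2
    obtain ⟨N, hN⟩ := (Set.finite_range ℓ).bddAbove
    refine ⟨N, ?_⟩
    rintro _ ⟨q, rfl⟩
    exact ⟨ℓ q, hN ⟨q, rfl⟩, hℓ q⟩
  refine (hR.mul hM).mono fun g hg => ?_
  refine ⟨_, ⟨QuotientGroup.mk ⟨g, hg⟩, rfl⟩, _, ?_, mul_inv_cancel_left _ g⟩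
  have h : (QuotientGroup.mk (s := M.subgroupOf (Subgroup.closure S)) ⟨g, hg⟩).out⁻¹ * ⟨g, hg⟩
      ∈ M.subgroupOf (Subgroup.closure S) := QuotientGroup.eq.1 (QuotientGroup.out_eq' _)
  exact h

end Words

/-! ### Torsion length in virtually abelian groups -/

section VirtuallyAbelian

variable {G : Type*} [Group G]

theorem inv_mem_torsionElements {t : G} (ht : t ∈ torsionElements G) :
    t⁻¹ ∈ torsionElements G :=
  IsOfFinOrder.inv ht

theorem conj_mem_torsionElements {t : G} (g : G) (ht : t ∈ torsionElements G) :
    g * t * g⁻¹ ∈ torsionElements G :=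
  (MulAut.conj g).toMonoidHom.isOfFinOrder ht

instance torsionSubgroup_normal : (torsionSubgroup G).Normal := by
  refine ⟨fun h hh g => ?_⟩
  rw [← MulAut.conj_apply]
  have : torsionSubgroup G ≤ (torsionSubgroup G).comap (MulAut.conj g).toMonoidHom :=
    (Subgroup.closure_le _).2 fun t ht =>
      Subgroup.subset_closure (conj_mem_torsionElements g ht)
  exact this hh

variable {A : Subgroup G}

open scoped IsMulCommutative

theorem HasBoundedLength.map_sup [IsMulCommutative A] {S : Set G} {K L : Subgroup A}
    (hK : HasBoundedLength S (K.map A.subtype : Set G))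
    (hL : HasBoundedLength S (L.map A.subtype : Set G)) :
    HasBoundedLength S ((K ⊔ L).map A.subtype : Set G) := by
  refine (hK.mul hL).mono ?_
  rintro _ ⟨x, hx, rfl⟩
  obtain ⟨y, hy, z, hz, rfl⟩ := Subgroup.mem_sup.1 hx
  exact ⟨_, ⟨y, hy, rfl⟩, _, ⟨z, hz, rfl⟩, (map_mul A.subtype y z).symm⟩

/-- The map `a ↦ ⁅g, a⁆` on an abelian normal subgroup. -/
def commutatorHom (A : Subgroup G) [A.Normal] [IsMulCommutative A] (g : G) : A →* A :=
  (MulAut.conjNormal g).toMonoidHom / MonoidHom.id A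

variable [A.Normal]

theorem coe_commutatorHom [IsMulCommutative A] (g : G) (a : A) :
    (commutatorHom A g a : G) = ⁅g, (a : G)⁆ := by
  simp [commutatorHom, commutatorElement_def, div_eq_mul_inv]

/-- As `A` is abelian, it acts trivially on itself by conjugation, so the action of `G` on `A`
factors through `G ⧸ A`. This is what makes the family of images finite. -/
theorem commutatorHom_eq [IsMulCommutative A] {g h : G} (hgh : g⁻¹ * h ∈ A) :
    commutatorHom A g = commutatorHom A h := by
  ext a
  have hc : (⟨_, hgh⟩ : A) * a = a * ⟨_, hgh⟩ := mul_comm _ _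
  replace hc : g⁻¹ * h * a = a * (g⁻¹ * h) := congrArg Subtype.val hc
  have e : h * a * h⁻¹ = g * a * g⁻¹ := by
    calc h * a * h⁻¹ = g * (g⁻¹ * h * a) * h⁻¹ := by group
      _ = g * a * g⁻¹ := by rw [hc]; group
  rw [coe_commutatorHom, coe_commutatorHom, commutatorElement_def, commutatorElement_def, e]

theorem hasBoundedLength_range_commutatorHom [IsMulCommutative A] {t : G}
    (ht : t ∈ torsionElements G) :
    HasBoundedLength (torsionElements G)
      ((commutatorHom A t).range.map A.subtype : Set G) := by
  refine ⟨2, ?_⟩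
  rintro _ ⟨_, ⟨a, rfl⟩, rfl⟩
  refine ⟨2, le_rfl, ?_⟩
  have e : A.subtype (commutatorHom A t a) = t * (a * t⁻¹ * (a : G)⁻¹) := by
    rw [Subgroup.subtype_apply, coe_commutatorHom, commutatorElement_def]
    group
  rw [e]
  exact (isProductOf_one ht).mul
    (isProductOf_one (conj_mem_torsionElements _ (inv_mem_torsionElements ht)))

theorem exists_hasBoundedLength_range_le [IsMulCommutative A] [A.FiniteIndex] :
    ∃ K : Subgroup A, HasBoundedLength (torsionElements G) (K.map A.subtype : Set G) ∧
      ∀ t ∈ torsionElements G, (commutatorHom A t).range ≤ K := by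
  have hfin : (Set.range fun t : torsionElements G => (commutatorHom A (t : G)).range).Finite := by
    have : Set.range (fun t : torsionElements G => (commutatorHom A (t : G)).range) ⊆
        Set.range fun q : G ⧸ A => (commutatorHom A q.out).range := by
      rintro _ ⟨t, rfl⟩
      refine ⟨(t : G), ?_⟩
      dsimp only
      rw [commutatorHom_eq (QuotientGroup.eq.1 (QuotientGroup.out_eq' ((t : G) : G ⧸ A)))]
    exact (Set.finite_range _).subset this
  have key : ∀ s : Finset (Subgroup A),
      (∀ L ∈ s, HasBoundedLength (torsionElements G) (L.map A.subtype : Set G)) →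
      ∃ K : Subgroup A, HasBoundedLength (torsionElements G) (K.map A.subtype : Set G) ∧
        ∀ L ∈ s, L ≤ K := by
    classical
    intro s
    induction s using Finset.induction_on with
    | empty =>
      refine fun _ => ⟨⊥, ⟨0, ?_⟩, by simp⟩
      rintro _ ⟨x, hx, rfl⟩
      rw [Subgroup.mem_bot.1 hx, map_one]
      exact ⟨0, le_rfl, isProductOf_zero⟩
    | insert L s _ ih =>
      intro h
      obtain ⟨K, hK, hKs⟩ := ih fun L' hL' => h L' (Finset.mem_insert_of_mem hL')
      refine ⟨L ⊔ K, (h L (Finset.mem_insert_self _ _)).map_sup hK, fun L' hL' => ?_⟩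
      rcases Finset.mem_insert.1 hL' with rfl | hL'
      · exact le_sup_left
      · exact (hKs L' hL').trans le_sup_right
  obtain ⟨K, hK, hle⟩ := key hfin.toFinset (by
    simp only [Set.Finite.mem_toFinset]
    rintro _ ⟨t, rfl⟩
    exact hasBoundedLength_range_commutatorHom t.2)
  exact ⟨K, hK, fun t ht => hle _ (by simpa using ⟨t, ht, rfl⟩)⟩

theorem hasBoundedLength_commutator [IsMulCommutative A] [A.FiniteIndex] :
    HasBoundedLength (torsionElements G) (⁅torsionSubgroup G, A⁆ : Subgroup G) := by
  obtain ⟨K, hK, hle⟩ := exists_hasBoundedLength_range_le (A := A)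
  refine hK.mono ?_
  rw [SetLike.coe_subset_coe, Subgroup.commutator_le]
  intro h hh
  -- The claim is proved for all `a` at once, because `⁅x * y, a⁆ = ⁅x, ⁅y, a⁆⁆ * ⁅y, a⁆ * ⁅x, a⁆`
  -- applies the hypothesis on `x` to `⁅y, a⁆` as well.
  have key : ∀ a : A, commutatorHom A h a ∈ K := by
    induction hh using Subgroup.closure_induction'' with
    | mem t ht => exact fun a => hle t ht ⟨a, rfl⟩
    | inv_mem t ht => exact fun a => hle t⁻¹ (inv_mem_torsionElements ht) ⟨a, rfl⟩
    | one =>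
      intro a
      have : commutatorHom A 1 a = 1 := by
        ext
        simp [coe_commutatorHom]
      rw [this]
      exact K.one_mem
    | mul x y _ _ hx hy =>
      intro a
      have : commutatorHom A (x * y) a
          = commutatorHom A x (commutatorHom A y a) * commutatorHom A y a
            * commutatorHom A x a := by
        rw [mul_assoc, mul_comm (commutatorHom A y a), ← mul_assoc, ← map_mul]
        ext
        simp only [coe_commutatorHom, Subgroup.coe_mul, commutatorElement_def]
        group
      rw [this]
      exact K.mul_mem (K.mul_mem (hx _) (hy a)) (hx a)
  intro a ha
  exact ⟨_, key ⟨a, ha⟩, coe_commutatorHom h ⟨a, ha⟩⟩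

/-- Modulo `⁅torsionSubgroup G, A⁆` the subgroup `A` is central, and the transfer to the centre shows
that the torsion subgroup becomes a torsion group. -/
theorem exists_pow_mem_commutator [A.FiniteIndex] {h : G} (hh : h ∈ torsionSubgroup G) :
    ∃ n > 0, h ^ n ∈ ⁅torsionSubgroup G, A⁆ := by
  set H := torsionSubgroup G with hH
  set M := ⁅H, A⁆.subgroupOf H with hM
  have hcenter : (Subgroup.center (H ⧸ M)).FiniteIndex := by
    refine ⟨?_⟩
    rw [← Subgroup.index_comap_of_surjective _ (QuotientGroup.mk'_surjective M)]
    refine ne_zero_of_dvd_ne_zero (Subgroup.FiniteIndex.index_ne_zero (H := A.subgroupOf H))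
      (Subgroup.index_dvd_of_le fun a ha => ?_)
    rw [Subgroup.mem_comap, Subgroup.mem_center_iff]
    intro q
    obtain ⟨x, rfl⟩ := QuotientGroup.mk'_surjective M q
    rw [← commutatorElement_eq_one_iff_mul_comm, ← map_commutatorElement]
    exact (QuotientGroup.eq_one_iff _).2 (Subgroup.commutator_mem_commutator x.2 ha)
  -- The transfer to the centre is the power map by the index of the centre, and so that power map
  -- is a homomorphism. Its target is abelian, where products of elements of finite order have
  -- finite order; hence it suffices to look at the torsion generators of `H`.
  let φ : H →* Subgroup.center (H ⧸ M) :=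
    (MonoidHom.transferCenterPow (H ⧸ M)).comp (QuotientGroup.mk' M)
  have hφ : ∀ (x : G) (hx : x ∈ H), IsOfFinOrder (φ ⟨x, hx⟩) := by
    intro x hx
    induction hx using Subgroup.closure_induction with
    | mem t ht => exact φ.isOfFinOrder (Submonoid.isOfFinOrder_coe.1 ht)
    | one => exact φ.isOfFinOrder (x := 1) .one
    | mul x y hx hy ihx ihy =>
      exact (map_mul φ ⟨x, hx⟩ ⟨y, hy⟩) ▸ ihx.mul ihy
    | inv x hx ihx => exact (map_inv φ ⟨x, hx⟩) ▸ ihx.inv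
  obtain ⟨n, hn, h1⟩ := isOfFinOrder_iff_pow_eq_one.1 (hφ h hh)
  refine ⟨(Subgroup.center (H ⧸ M)).index * n,
    Nat.mul_pos (Nat.pos_of_ne_zero hcenter.index_ne_zero) hn, ?_⟩
  have h2 : (QuotientGroup.mk' M ⟨h, hh⟩) ^ ((Subgroup.center (H ⧸ M)).index * n) = 1 := by
    rw [pow_mul]
    exact congrArg Subtype.val h1
  rw [← map_pow] at h2
  have h3 : (⟨h, hh⟩ : H) ^ ((Subgroup.center (H ⧸ M)).index * n) ∈ M :=
    (QuotientGroup.eq_one_iff _).1 h2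
  exact h3

/-- In a finitely generated virtually abelian group, the subgroup generated by the torsion elements
is boundedly generated by them. -/
theorem hasBoundedLength_torsionSubgroup [Group.FG G] [IsMulCommutative A] [A.FiniteIndex] :
    HasBoundedLength (torsionElements G) (torsionSubgroup G : Set G) := by
  refine HasBoundedLength.closure_of_relIndex_ne_zero
    (fun _ => inv_mem_torsionElements) (hasBoundedLength_commutator (A := A)) ?_
  change Subgroup.relIndex _ (torsionSubgroup G) ≠ 0
  -- Passing through the intersection with `A` puts the torsion argument inside a finitely generated
  -- abelian group.
  refine Subgroup.relIndex_ne_zero_trans (K := torsionSubgroup G ⊓ A) ?_ ?_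
  · rw [← Subgroup.relIndex_subgroupOf (inf_le_right : torsionSubgroup G ⊓ A ≤ A)]
    refine relIndex_ne_zero_of_forall_exists_pow_mem fun x hx => ?_
    exact exists_pow_mem_commutator (A := A) hx.1
  · rw [Subgroup.inf_relIndex_left]
    exact Subgroup.FiniteIndex.index_ne_zero (H := A.subgroupOf _)

end VirtuallyAbelian

theorem wordLength_le_of_isProductOf {G : Type*} [Group G] {S : Set G} {k : ℕ} {g : G}
    (h : IsProductOf S k g) : wordLength S g ≤ k :=
  Nat.sInf_le h

theorem tendsto_tl_pow_div {G : Type*} [Group G]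
    (h : HasBoundedLength (torsionElements G) (torsionSubgroup G : Set G)) {g : G}
    (hg : g ∈ torsionSubgroup G) :
    Tendsto (fun k : ℕ => (tl (g ^ k) : ℝ) / (k : ℝ)) atTop (𝓝 0) := by
  obtain ⟨N, hN⟩ := h
  refine squeeze_zero (fun k => by positivity) (fun k => ?_)
    (tendsto_const_div_atTop_nhds_zero_nat (N : ℝ))
  obtain ⟨j, hj, hgj⟩ := hN _ (Subgroup.pow_mem _ hg k)
  have : tl (g ^ k) ≤ N := (wordLength_le_of_isProductOf hgj).trans hj
  gcongr

end StableTorsion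

theorem theorem3p1 (n : ℕ) (Γ : Subgroup (StableTorsion.EuclIsom n))
    (hΓ : StableTorsion.IsCrystallographic Γ) :
    StableTorsion.IsBoundedlyGeneratedBy (StableTorsion.torsionSubgroup Γ)
        (StableTorsion.torsionElements Γ) ∧
      ∀ g ∈ StableTorsion.torsionSubgroup Γ,
        Filter.Tendsto (fun k : ℕ => (StableTorsion.tl (g ^ k) : ℝ) / (k : ℝ)) Filter.atTop
            (nhds (StableTorsion.stl g)) ∧
          StableTorsion.stl g = 0 := by
  have hc := hΓ.hasCoboundedOrbit
  have hd := hΓ.isUniformlyDiscrete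
  have : Group.FG Γ := (Group.fg_iff_subgroup_fg Γ).2 (hc.fg hd.finite_setOf_norm_le)
  have := StableTorsion.finiteIndex_translations hc hd
  have : (StableTorsion.translations Γ).Normal := MonoidHom.normal_ker _
  have : IsMulCommutative (StableTorsion.translations Γ) :=
    ⟨⟨fun α β => Subtype.ext (StableTorsion.mul_comm_of_mem_translations α.2 β.2)⟩⟩
  have hb := StableTorsion.hasBoundedLength_torsionSubgroup (A := StableTorsion.translations Γ)
  refine ⟨⟨rfl, hb⟩, fun g hg => ?_⟩
  have ht := StableTorsion.tendsto_tl_pow_div hb hg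
  have h0 : StableTorsion.stl g = 0 := ht.limUnder_eq
  exact ⟨h0 ▸ ht, h0⟩
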